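/- Notation. A finite set $s\subset\mathbb N$ is written $s=\{s(1)<\dots<s(|s|)\}$. A family $\mathcal B$ of finite subsets of $\mathbb N$ is a \emph{barrier} if every infinite $M\subseteq\mathbb N$ has an initial segment in $\mathcal B$ and no member of $\mathcal B$ is contained in a different member. For $M\subseteq\mathbb N$ put $\mathcal B\upharpoonright_M=\{s\in\mathcal B: s\subseteq M\}$. A tuple $(s_i)_{i=1}^n$ of finite subsets of $\mathbb N$ is \emph{plegma} if $|s_1|\le\dots\le|s_n|$, $s_i(k)<s_j(k)$ whenever $i<j$ and $k\le|s_i|$, and $s_i(k)<s_j(k+1)$ for all $i,j$ and all $k\ge 1$ with $k\le|s_i|$ and $k+1\le|s_j|$; $\mathrm{Plm}_n(\mathcal B)$ is the set of plegma tuples of length $n$ with entries in $\mathcal B$. Let $\mathcal N_n$ be the set of seminorms $\rho$ on $\mathbb R^n$ with $\rho(e_i)=1$ for $i=1,\dots,n$, with the metric $d_n(\rho,\sigma)=\sup\{|\rho(a)-\sigma(a)|: a\in[-1,1]^n\}$. Seminorms $\rho_n\in\mathcal N_n$ and $\rho_m\in\mathcal N_m$ with $n<m$ are \emph{compatible} if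 $\rho_m\upharpoonright_{\mathbb R^n}=\rho_n$. A \emph{$\mathcal B\times\mathbb N$-matrix} in a real Banach space $X$ is a family $(x^i_s)_{s\in\mathcal B,\,i\in\mathbb N}$ of vectors of norm $1$ in $X$; it induces maps $\Psi^n:\mathrm{Plm}_n(\mathcal B)\to\mathcal N_n$, $\Psi^n((s_i)_{i=1}^n)(a)=\big\|\sum_{i=1}^n a_i x^i_{s_i}\big\|$. We say that $\Psi^n$ \emph{converges to $\rho\in\mathcal N_n$ on $M$} if there are positive reals $\varepsilon_m\searrow 0$ such that $d_n(\Psi^n(s),\rho)<\varepsilon_m$ for every $s=(s_i)_{i=1}^n\in\mathrm{Plm}_n(\mathcal B\upharpoonright_M)$ and every $m\in\mathbb N$ with $m\le k$ for all $k\in\bigcup_i s_i$ (so $d_n(\Psi^n(s),\rho)<\varepsilon_{\min\bigcup_i s_i}$ if $\bigcup_i s_i\ne\emptyset$). Theorem. Let $X$ be a real Banach space, $\mathcal B$ a barrier and $(x^i_s)_{s\in\mathcal B,\,i\in\mathbb N}$ a $\mathcal B\times\mathbb N$-matrix in $X$. Then for every infinite $N\subseteq\mathbb N$ there are an infinite $M\subseteq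 N$ and seminorms $\rho_n\in\mathcal N_n$, $n\in\mathbb N$, which are pairwise compatible and such that, for every $n\in\mathbb N$, the map $\Psi^n$ converges to $\rho_n$ on $M$. -/

import Mathlib

/-- `s` is an initial segment of `M`: `s ⊆ M`, and `s` contains every element of `M` that lies
below some element of `s`. -/
def IsInitialSegmentOf (s : Finset ℕ) (M : Set ℕ) : Prop :=
  (s : Set ℕ) ⊆ M ∧ ∀ k ∈ s, ∀ m ∈ M, m < k → m ∈ s

/-- A barrier: a family of finite sets of natural numbers, pairwise incomparable for inclusion,
such that every infinite set has an initial segment in the family. -/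
structure IsBarrier (B : Set (Finset ℕ)) : Prop where
  exists_initial : ∀ M : Set ℕ, M.Infinite → ∃ s ∈ B, IsInitialSegmentOf s M
  antichain : ∀ s ∈ B, ∀ t ∈ B, s ≠ t → ¬ s ⊆ t ∧ ¬ t ⊆ s

/-- The restriction of a family to `M`: its members that are subsets of `M`. -/
def restrictFamily (F : Set (Finset ℕ)) (M : Set ℕ) : Set (Finset ℕ) :=
  {s | s ∈ F ∧ (s : Set ℕ) ⊆ M}

/-- The elements of `s` in increasing order, numbered from `0`: `increasingEnum s k` is the element
usually written `s(k + 1)`. -/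
def increasingEnum (s : Finset ℕ) (k : Fin s.card) : ℕ :=
  s.orderEmbOfFin rfl k

/-- A plegma tuple: the sizes are nondecreasing; at each level the entries that exist increase with
the index of the set; and all entries of a level lie below all entries of the next level. -/
structure IsPlegma {n : ℕ} (s : Fin n → Finset ℕ) : Prop where
  card_mono : Monotone fun i => (s i).card
  lt_same_level : ∀ (i j : Fin n), i < j → ∀ (k : ℕ) (hi : k < (s i).card) (hj : k < (s j).card),
    increasingEnum (s i) ⟨k, hi⟩ < increasingEnum (s j) ⟨k, hj⟩
  lt_next_level : ∀ (i j : Fin n) (k : ℕ) (hi : k < (s i).card) (hj : k + 1 < (s j).card),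
    increasingEnum (s i) ⟨k, hi⟩ < increasingEnum (s j) ⟨k + 1, hj⟩

/-- The `n`-plegma family of a family `B`. -/
def plegmaFamily (B : Set (Finset ℕ)) (n : ℕ) : Set (Fin n → Finset ℕ) :=
  {s | (∀ i, s i ∈ B) ∧ IsPlegma s}

/-- The space of seminorms on `ℝⁿ` that take the value `1` on each unit vector. -/
def NormalizedSeminorm (n : ℕ) : Type :=
  {ρ : Seminorm ℝ (Fin n → ℝ) // ∀ i, ρ (Pi.single i 1) = 1}

namespace NormalizedSeminorm

variable {n : ℕ}

instance : CoeFun (NormalizedSeminorm n) (fun _ => (Fin n → ℝ) → ℝ) :=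
  ⟨fun ρ => ρ.1⟩

theorem le_sum_abs (ρ : NormalizedSeminorm n) (a : Fin n → ℝ) : ρ a ≤ ∑ i, |a i| := by
  have h : a = ∑ i, a i • (Pi.single i (1 : ℝ) : Fin n → ℝ) := by
    ext j
    simp [Finset.sum_apply, Pi.single_apply]
  have h2 : ρ.1 (∑ i, a i • (Pi.single i (1 : ℝ) : Fin n → ℝ)) ≤
      ∑ i, ρ.1 (a i • (Pi.single i (1 : ℝ) : Fin n → ℝ)) :=
    Finset.le_sum_of_subadditive ρ.1 (map_zero ρ.1).le (map_add_le_add ρ.1) _ _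
  rw [← h] at h2
  refine h2.trans (le_of_eq ?_)
  refine Finset.sum_congr rfl fun i _ => ?_
  rw [map_smul_eq_mul, ρ.2 i, mul_one, Real.norm_eq_abs]

theorem nonneg (ρ : NormalizedSeminorm n) (a : Fin n → ℝ) : 0 ≤ ρ a :=
  apply_nonneg ρ.1 a

theorem abs_sub_le_of_mem (ρ σ : NormalizedSeminorm n) (a : Set.Icc (-1 : Fin n → ℝ) 1) :
    |ρ a - σ a| ≤ n := by
  have ha : ∑ i, |(a : Fin n → ℝ) i| ≤ n := by
    refine (Finset.sum_le_card_nsmul _ _ 1 fun i _ => ?_).trans (by simp)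
    exact abs_le.2 ⟨a.2.1 i, a.2.2 i⟩
  have h1 := ρ.le_sum_abs a
  have h2 := σ.le_sum_abs a
  have h3 := ρ.nonneg a
  have h4 := σ.nonneg a
  exact abs_le.2 ⟨by linarith, by linarith⟩

/-- The distance `sup {|ρ a - σ a| : a ∈ [-1, 1]ⁿ}`. -/
noncomputable instance : Dist (NormalizedSeminorm n) :=
  ⟨fun ρ σ => ⨆ a : Set.Icc (-1 : Fin n → ℝ) 1, |ρ a - σ a|⟩

theorem dist_def (ρ σ : NormalizedSeminorm n) :
    dist ρ σ = ⨆ a : Set.Icc (-1 : Fin n → ℝ) 1, |ρ a - σ a| := rfl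

theorem bddAbove_range (ρ σ : NormalizedSeminorm n) :
    BddAbove (Set.range fun a : Set.Icc (-1 : Fin n → ℝ) 1 => |ρ a - σ a|) :=
  ⟨n, by rintro _ ⟨a, rfl⟩; exact abs_sub_le_of_mem ρ σ a⟩

theorem abs_sub_le_dist (ρ σ : NormalizedSeminorm n) (a : Set.Icc (-1 : Fin n → ℝ) 1) :
    |ρ a - σ a| ≤ dist ρ σ :=
  le_ciSup (bddAbove_range ρ σ) a

instance : Nonempty (Set.Icc (-1 : Fin n → ℝ) 1) :=
  ⟨⟨0, fun _ => by simp, fun _ => by simp⟩⟩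

theorem ext_of_eqOn_cube (ρ σ : NormalizedSeminorm n)
    (h : ∀ a : Set.Icc (-1 : Fin n → ℝ) 1, ρ a = σ a) : ρ = σ := by
  apply Subtype.ext
  ext a
  have hpos : 0 < ‖a‖ + 1 := by positivity
  have hmem : (‖a‖ + 1)⁻¹ • a ∈ Set.Icc (-1 : Fin n → ℝ) 1 := by
    have key : ∀ i, |((‖a‖ + 1)⁻¹ • a) i| ≤ 1 := fun i => by
      rw [Pi.smul_apply, smul_eq_mul, abs_mul, abs_of_pos (inv_pos.2 hpos), inv_mul_le_iff₀ hpos]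
      have := norm_le_pi_norm a i
      rw [Real.norm_eq_abs] at this
      linarith
    exact ⟨fun i => (abs_le.1 (key i)).1, fun i => (abs_le.1 (key i)).2⟩
  have h1 : ρ.1 ((‖a‖ + 1)⁻¹ • a) = σ.1 ((‖a‖ + 1)⁻¹ • a) := h ⟨_, hmem⟩
  rw [map_smul_eq_mul, map_smul_eq_mul] at h1
  refine mul_left_cancel₀ ?_ h1
  rw [norm_ne_zero_iff]
  exact (inv_pos.2 hpos).ne'

noncomputable instance : MetricSpace (NormalizedSeminorm n) where
  dist_self ρ := by simp [dist_def]
  dist_comm ρ σ := by simp only [dist_def, abs_sub_comm]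
  dist_triangle ρ σ τ := by
    rw [dist_def ρ τ]
    exact ciSup_le fun a => (abs_sub_le _ (σ a) _).trans
      (add_le_add (abs_sub_le_dist ρ σ a) (abs_sub_le_dist σ τ a))
  eq_of_dist_eq_zero {ρ σ} h := ext_of_eqOn_cube ρ σ fun a =>
    sub_eq_zero.1 (abs_nonpos_iff.1 (h ▸ abs_sub_le_dist ρ σ a))

end NormalizedSeminorm

/-- Extension of a vector by zeros; for `n ≤ m` this is the usual inclusion of `ℝⁿ` in `ℝᵐ`. -/
def extendByZero {n : ℕ} (m : ℕ) (a : Fin n → ℝ) : Fin m → ℝ :=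
  fun i => if h : (i : ℕ) < n then a ⟨i, h⟩ else 0

/-- For `n < m`: the restriction of `σ` to `ℝⁿ` is `ρ`. -/
def Compatible {n m : ℕ} (ρ : NormalizedSeminorm n) (σ : NormalizedSeminorm m) : Prop :=
  ∀ a : Fin n → ℝ, σ (extendByZero m a) = ρ a

/-- An `F × ℕ`-matrix in `X`: a sequence (indexed by `ℕ`) of families of unit vectors of `X`
indexed by `F`. -/
abbrev FamilyMatrix (F : Set (Finset ℕ)) (X : Type*) [NormedAddCommGroup X] : Type _ :=
  ℕ → F → Metric.sphere (0 : X) 1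

/-- The map that sends an `n`-plegma tuple `s` in `B` to the seminorm
`a ↦ ‖∑ i, a i • x i (s i)‖` on `ℝⁿ`. -/
noncomputable def inducedSeminorm {X : Type*} [NormedAddCommGroup X] [NormedSpace ℝ X]
    {B : Set (Finset ℕ)} (x : FamilyMatrix B X) (n : ℕ) (s : plegmaFamily B n) :
    NormalizedSeminorm n :=
  ⟨Seminorm.of (fun a => ‖∑ i : Fin n, a i • (x i ⟨s.1 i, s.2.1 i⟩ : X)‖)
    (fun a b => by
      simp only [Pi.add_apply, add_smul, Finset.sum_add_distrib]
      exact norm_add_le _ _)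
    (fun c a => by
      simp only [Pi.smul_apply, smul_eq_mul, mul_smul, ← Finset.smul_sum]
      exact norm_smul _ _),
    fun i => by
      change ‖∑ j : Fin n, (Pi.single i (1 : ℝ) : Fin n → ℝ) j •
        (x j ⟨s.1 j, s.2.1 j⟩ : X)‖ = 1
      rw [Finset.sum_eq_single i (fun j _ hj => by simp [Pi.single_eq_of_ne hj])
        (fun h => absurd (Finset.mem_univ i) h)]
      simp⟩

/-- A function `Φ` on the `n`-plegma tuples of `B` converges to `y` on `M`: there are positive
reals `ε 0 ≥ ε 1 ≥ ...` tending to `0` such that `Φ s` is within `ε m` of `y` for every plegma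
tuple `s` of members of `B` contained in `M` and every `m` not above any element of any `s i`.
If `⋃ i, s i` is nonempty, this says exactly that the distance is less than `ε (min (⋃ i, s i))`. -/
def PlegmaConvergesOn {B : Set (Finset ℕ)} {n : ℕ} {Y : Type*} [MetricSpace Y]
    (Φ : plegmaFamily B n → Y) (M : Set ℕ) (y : Y) : Prop :=
  ∃ ε : ℕ → ℝ, (∀ m, 0 < ε m) ∧ Antitone ε ∧ Filter.Tendsto ε Filter.atTop (nhds 0) ∧
    ∀ s : plegmaFamily B n, (s : Fin n → Finset ℕ) ∈ plegmaFamily (restrictFamily B M) n →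
      ∀ m : ℕ, (∀ i, ∀ k ∈ (s : Fin n → Finset ℕ) i, m ≤ k) → dist (Φ s) y < ε m

/-! The heart is a Ramsey theorem for finite colourings of plegma tuples in a barrier. A plegma
tuple is interleaved: its entries increase in the lexicographic order of (level, index). Since a
barrier is an antichain, this order lets one recover the tuple from its union: interleaved tuples
whose unions are initial segments of one set coincide (`IsInterleaved.eq_of_isInitialSegmentOf`). So
Galvin's lemma, applied to the unions of the tuples of one colour, makes that colour either absent
or the only one on some infinite set.

The space of normalized seminorms on `ℝⁿ` is totally bounded, so colouring by small cells makes the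
seminorms of `n`-tuples oscillate little. Diagonalizing over all `n` and all precisions gives one
`M`, and completeness gives the limits `ρ n`. Compatibility follows by evaluating along `m`-tuples
that move to infinity and along their first `n` entries. -/

/-! ### Fusion of dense hereditary properties. -/

/-- A hereditary family of properties, each of which every infinite set acquires by shrinking, can
be shrunk to simultaneously for finitely many indices. -/
theorem exists_infinite_subset_forall_mem_finset {ι : Type*} {P : ι → Set ℕ → Prop}
    (hered : ∀ i, ∀ S T : Set ℕ, T ⊆ S → P i S → P i T)
    (dense : ∀ i, ∀ N : Set ℕ, N.Infinite → ∃ M ⊆ N, M.Infinite ∧ P i M)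
    (I : Finset ι) (N : Set ℕ) (hN : N.Infinite) :
    ∃ M ⊆ N, M.Infinite ∧ ∀ i ∈ I, P i M := by
  classical
  induction I using Finset.induction_on with
  | empty => exact ⟨N, subset_rfl, hN, by simp⟩
  | insert i I _ ih =>
    obtain ⟨M, hMN, hM, hI⟩ := ih
    obtain ⟨M', hM'M, hM', hi⟩ := dense i M hM
    refine ⟨M', hM'M.trans hMN, hM', fun j hj => ?_⟩
    rcases Finset.mem_insert.1 hj with rfl | hj
    · exact hi
    · exact hered j M M' hM'M (hI j hj)

/-- The elements of `M` above all elements of `s`. -/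
def tailAbove (s : Finset ℕ) (M : Set ℕ) : Set ℕ :=
  {m | m ∈ M ∧ ∀ k ∈ s, k < m}

theorem tailAbove_subset (s : Finset ℕ) (M : Set ℕ) : tailAbove s M ⊆ M := fun _ h => h.1

theorem infinite_tailAbove (s : Finset ℕ) {M : Set ℕ} (hM : M.Infinite) :
    (tailAbove s M).Infinite := by
  refine (hM.sdiff (Set.finite_Iic (s.sup id))).mono fun m hm => ⟨hm.1, fun k hk => ?_⟩
  exact (Finset.le_sup (f := id) hk).trans_lt (not_le.1 hm.2)

/-- Fusion: dense hereditary properties indexed by finite sets hold, for every finite subset of a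
suitable infinite set, on the part of that set above it. -/
theorem exists_fusion {P : Finset ℕ → Set ℕ → Prop}
    (hered : ∀ s, ∀ S T : Set ℕ, T ⊆ S → P s S → P s T)
    (dense : ∀ s, ∀ N : Set ℕ, N.Infinite → ∃ M ⊆ N, M.Infinite ∧ P s M)
    (N : Set ℕ) (hN : N.Infinite) :
    ∃ M ⊆ N, M.Infinite ∧ ∀ s : Finset ℕ, (s : Set ℕ) ⊆ M → P s (tailAbove s M) := by
  classical
  -- All subsets of `[0, sInf S]` are treated at once, so every finite set of points selected so far
  -- is covered.
  have step : ∀ S : {S : Set ℕ // S.Infinite}, ∃ T : {S : Set ℕ // S.Infinite},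
      T.1 ⊆ S.1 ∧ (∀ m ∈ T.1, sInf S.1 < m) ∧
      ∀ s ∈ (Finset.range (sInf S.1 + 1)).powerset, P s T.1 := by
    rintro ⟨S, hS⟩
    obtain ⟨T, hTS, hT, h⟩ := exists_infinite_subset_forall_mem_finset hered dense
      (Finset.range (sInf S + 1)).powerset _ (infinite_tailAbove {sInf S} hS)
    exact ⟨⟨T, hT⟩, hTS.trans (tailAbove_subset _ _),
      fun m hm => (hTS hm).2 _ (Finset.mem_singleton_self _), h⟩
  choose next hsub hlt hP using step
  -- The empty set has no maximum to locate it in the construction, so it is settled before the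
  -- start.
  obtain ⟨N₀, hN₀, hinf, h₀⟩ := dense ∅ N hN
  let S : ℕ → {S : Set ℕ // S.Infinite} := fun k => next^[k] ⟨N₀, hinf⟩
  have hS : ∀ k, S (k + 1) = next (S k) := fun k => Function.iterate_succ_apply' _ _ _
  have hanti : Antitone fun k => (S k).1 := antitone_nat_of_succ_le fun k => by
    simp only [hS]; exact hsub _
  let m : ℕ → ℕ := fun k => sInf (S k).1
  have hm : ∀ k, m k ∈ (S k).1 := fun k => Nat.sInf_mem (S k).2.nonempty
  have hmono : StrictMono m := strictMono_nat_of_lt_succ fun k => by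
    have := hm (k + 1)
    rw [hS] at this
    exact hlt _ _ this
  refine ⟨Set.range m, ?_, Set.infinite_range_of_injective hmono.injective, fun s hs => ?_⟩
  · rintro _ ⟨k, rfl⟩
    exact hN₀ (hanti (Nat.zero_le k) (hm k))
  rcases s.eq_empty_or_nonempty with rfl | hne
  · refine hered _ _ _ ?_ h₀
    rintro _ ⟨⟨k, rfl⟩, -⟩
    exact hanti (Nat.zero_le k) (hm k)
  · obtain ⟨k, hk⟩ := hs (s.max'_mem hne)
    refine hered _ (S (k + 1)).1 _ ?_ ?_
    · rintro _ ⟨⟨l, rfl⟩, hl⟩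
      have := hl _ (s.max'_mem hne)
      rw [← hk] at this
      exact hanti (hmono.lt_iff_lt.1 this) (hm l)
    · rw [hS]
      refine hP _ _ (Finset.mem_powerset.2 fun a ha => Finset.mem_range.2 ?_)
      have := s.le_max' a ha
      rw [← hk] at this
      exact Nat.lt_succ_of_le this

/-! ### Galvin's lemma by acceptance and rejection. -/

/-- Every infinite set that continues `s` inside `M` has an initial segment in `F`. -/
def Accepts (F : Set (Finset ℕ)) (s : Finset ℕ) (M : Set ℕ) : Prop :=
  ∀ L ⊆ tailAbove s M, L.Infinite → ∃ t ∈ F, IsInitialSegmentOf t (s ∪ L)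

theorem tailAbove_mono (s : Finset ℕ) {M N : Set ℕ} (h : M ⊆ N) :
    tailAbove s M ⊆ tailAbove s N := fun _ hm => ⟨h hm.1, hm.2⟩

theorem Accepts.mono {F : Set (Finset ℕ)} {s : Finset ℕ} {M N : Set ℕ} (h : Accepts F s N)
    (hMN : M ⊆ N) : Accepts F s M :=
  fun L hL => h L (hL.trans (tailAbove_mono s hMN))

theorem isInitialSegmentOf_union {s : Finset ℕ} {L : Set ℕ} (h : ∀ m ∈ L, ∀ k ∈ s, k < m) :
    IsInitialSegmentOf s (s ∪ L) := by
  refine ⟨Set.subset_union_left, fun k hk m hm hmk => ?_⟩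
  rcases hm with hm | hm
  · exact hm
  · exact absurd (h m hm k hk) (by omega)

/-- Fusion of the dichotomy "accepts `s`, or has no infinite subset accepting `s`". Acceptance
depends only on the points above `s`, so a decision on the tail is one on `M`. -/
theorem exists_forall_accepts_of_accepts (F : Set (Finset ℕ)) (N : Set ℕ) (hN : N.Infinite) :
    ∃ M ⊆ N, M.Infinite ∧ ∀ s : Finset ℕ, (s : Set ℕ) ⊆ M → ∀ M' ⊆ M, M'.Infinite →
      Accepts F s M' → Accepts F s M := by
  obtain ⟨M, hMN, hM, h⟩ := exists_fusion
    (P := fun s M => Accepts F s M ∨ ∀ M' ⊆ M, M'.Infinite → ¬ Accepts F s M')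
    (fun s S T hTS => Or.imp (fun h => h.mono hTS) fun h M' hM' => h M' (hM'.trans hTS))
    (fun s N hN => by
      by_cases h : ∃ M ⊆ N, M.Infinite ∧ Accepts F s M
      · obtain ⟨M, hMN, hM, h⟩ := h
        exact ⟨M, hMN, hM, Or.inl h⟩
      · push Not at h
        exact ⟨N, subset_rfl, hN, Or.inr h⟩) N hN
  refine ⟨M, hMN, hM, fun s hs M' hM'M hM' hacc => ?_⟩
  rcases h s hs with h | h
  · exact fun L hL => h L fun m hm => ⟨hL hm, (hL hm).2⟩
  · exact absurd (hacc.mono (tailAbove_subset s M')) (h _ (tailAbove_mono s hM'M)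
      (infinite_tailAbove s hM'))

/-- Galvin's lemma. -/
theorem exists_avoids_or_forall_exists_initial (F : Set (Finset ℕ)) (N : Set ℕ)
    (hN : N.Infinite) :
    ∃ M ⊆ N, M.Infinite ∧ ((∀ s ∈ F, ¬ (s : Set ℕ) ⊆ M) ∨
      ∀ L ⊆ M, L.Infinite → ∃ t ∈ F, IsInitialSegmentOf t L) := by
  classical
  obtain ⟨M, hMN, hM, hdec⟩ := exists_forall_accepts_of_accepts F N hN
  by_cases hacc : Accepts F ∅ M
  · refine ⟨M, hMN, hM, Or.inr fun L hL hinf => ?_⟩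
    simpa using hacc L (fun m hm => ⟨hL hm, by simp⟩) hinf
  -- If the set of such `n` were infinite, it would accept `s`: an infinite `L` inside it continues
  -- `insert n s` with `n` its minimum. Then `M` would accept `s` by `hdec`.
  have hfin : ∀ s : Finset ℕ, (s : Set ℕ) ⊆ M → ¬ Accepts F s M →
      {n | n ∈ tailAbove s M ∧ Accepts F (insert n s) M}.Finite := by
    intro s hs hrej
    by_contra hinf
    refine hrej (hdec s hs {n | n ∈ tailAbove s M ∧ Accepts F (insert n s) M}
      (fun n hn => hn.1.1) hinf fun L hL hLinf => ?_)
    have hmin := Nat.sInf_mem hLinf.nonempty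
    have h1 := (hL hmin).1.2 (L \ {sInf L}) (fun m hm => ⟨(hL hm.1).1.1.1, fun k hk => ?_⟩)
      (hLinf.sdiff (Set.finite_singleton _))
    · obtain ⟨t, ht, hi⟩ := h1
      refine ⟨t, ht, ?_⟩
      convert hi using 1
      rw [Finset.coe_insert, Set.insert_union, ← Set.union_insert, Set.insert_sdiff_singleton,
        Set.insert_eq_of_mem hmin]
    · rcases Finset.mem_insert.1 hk with rfl | hk
      · exact lt_of_le_of_ne (Nat.sInf_le hm.1) (Ne.symm hm.2)
      · exact (hL hm.1).2 k hk
  obtain ⟨M₂, hM₂M, hM₂, h⟩ := exists_fusion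
    (P := fun s S => (s : Set ℕ) ⊆ M → ¬ Accepts F s M →
      ∀ n ∈ S, n ∈ tailAbove s M → ¬ Accepts F (insert n s) M)
    (fun s S T hTS h hs hrej n hn => h hs hrej n (hTS hn))
    (fun s S hS => by
      by_cases hs : (s : Set ℕ) ⊆ M ∧ ¬ Accepts F s M
      · exact ⟨_, Set.sdiff_subset, hS.sdiff (hfin s hs.1 hs.2),
          fun _ _ n hn hn' ha => hn.2 ⟨hn', ha⟩⟩
      · exact ⟨S, subset_rfl, hS, fun h1 h2 => absurd ⟨h1, h2⟩ hs⟩) M hM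
  have hrej : ∀ s : Finset ℕ, (s : Set ℕ) ⊆ M₂ → ¬ Accepts F s M := by
    intro s
    induction s using Finset.induction_on_max with
    | empty => exact fun _ => hacc
    | insert n s hn ih =>
      intro hs
      rw [Finset.coe_insert, Set.insert_subset_iff] at hs
      exact h s hs.2 (hs.2.trans hM₂M) (ih hs.2) n ⟨hs.1, hn⟩ ⟨hM₂M hs.1, hn⟩
  -- A member of `F` is accepted by any set, being itself the required initial segment.
  refine ⟨M₂, hM₂M.trans hMN, hM₂, Or.inl fun s hs hsM => hrej s hsM fun L hL _ => ?_⟩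
  exact ⟨s, hs, isInitialSegmentOf_union fun m hm => (hL hm).2⟩

/-- Diagonalization over countably many dense hereditary properties. -/
theorem exists_infinite_subset_forall_exists_tail {ι : Type*} [Countable ι]
    {P : ι → Set ℕ → Prop}
    (hered : ∀ i, ∀ S T : Set ℕ, T ⊆ S → P i S → P i T)
    (dense : ∀ i, ∀ N : Set ℕ, N.Infinite → ∃ M ⊆ N, M.Infinite ∧ P i M)
    (N : Set ℕ) (hN : N.Infinite) :
    ∃ M ⊆ N, M.Infinite ∧ ∀ i, ∃ a, P i (M ∩ Set.Ici a) := by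
  classical
  obtain ⟨f, hf⟩ := exists_injective_nat ι
  -- Only the size of `s` matters: any `f i` points of `M` force property `i` on the part of `M`
  -- above them.
  obtain ⟨M, hMN, hM, h⟩ := exists_fusion (P := fun s S => ∀ i, f i ≤ s.card → P i S)
    (fun s S T hTS h i hi => hered i S T hTS (h i hi))
    (fun s N hN => by
      have hfin : {i | f i ≤ s.card}.Finite := (Set.finite_Iic s.card).preimage hf.injOn
      obtain ⟨M, hMN, hM, h⟩ :=
        exists_infinite_subset_forall_mem_finset hered dense hfin.toFinset N hN
      exact ⟨M, hMN, hM, fun i hi => h i (hfin.mem_toFinset.2 hi)⟩) N hN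
  refine ⟨M, hMN, hM, fun i => ?_⟩
  obtain ⟨s, hs, hcard⟩ := hM.exists_subset_card_eq (f i)
  refine ⟨s.sup id + 1, hered i _ _ ?_ (h s hs i hcard.ge)⟩
  exact fun m hm => ⟨hm.1, fun k hk =>
    (Finset.le_sup (f := id) hk).trans_lt (Nat.lt_of_succ_le hm.2)⟩

/-! ### Interleaved tuples and their unions. -/

/-- The number of elements of `s` below `v`. -/
def rankIn (s : Finset ℕ) (v : ℕ) : ℕ :=
  (s.filter (· < v)).card

theorem rankIn_congr {s t : Finset ℕ} {v : ℕ} (h : ∀ u < v, (u ∈ s ↔ u ∈ t)) :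
    rankIn s v = rankIn t v := by
  unfold rankIn
  congr 1
  ext u
  simp only [Finset.mem_filter]
  exact and_congr_left fun hu => h u hu

theorem exists_mem_rankIn_eq {s : Finset ℕ} {v w : ℕ} (hw : w ∈ s) (hvw : v ≤ w) :
    ∃ u ∈ s, v ≤ u ∧ rankIn s u = rankIn s v := by
  have hne : (s.filter (v ≤ ·)).Nonempty := ⟨w, Finset.mem_filter.2 ⟨hw, hvw⟩⟩
  have hmem := Finset.mem_filter.1 (Finset.min'_mem _ hne)
  refine ⟨_, hmem.1, hmem.2, ?_⟩
  unfold rankIn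
  congr 1
  ext a
  simp only [Finset.mem_filter]
  refine and_congr_right fun ha => ⟨fun h => ?_, fun h => h.trans_le hmem.2⟩
  by_contra hav
  exact absurd (Finset.min'_le _ a (Finset.mem_filter.2 ⟨ha, not_lt.1 hav⟩)) (not_le.2 h)

theorem exists_increasingEnum_eq {s : Finset ℕ} {v : ℕ} (hv : v ∈ s) :
    ∃ h : rankIn s v < s.card, increasingEnum s ⟨rankIn s v, h⟩ = v := by
  have hr : v ∈ Set.range (s.orderEmbOfFin rfl) := by
    rw [Finset.range_orderEmbOfFin]; exact hv
  obtain ⟨k, rfl⟩ := hr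
  have : rankIn s (s.orderEmbOfFin rfl k) = k := by
    unfold rankIn
    have : s.filter (· < s.orderEmbOfFin rfl k) =
        (Finset.Iio k).map (s.orderEmbOfFin rfl).toEmbedding := by
      ext u
      simp only [Finset.mem_filter, Finset.mem_map, Finset.mem_Iio]
      constructor
      · rintro ⟨hu, hlt⟩
        have hr : u ∈ Set.range (s.orderEmbOfFin rfl) := by
          rw [Finset.range_orderEmbOfFin]; exact hu
        obtain ⟨l, rfl⟩ := hr
        exact ⟨l, (OrderEmbedding.lt_iff_lt _).1 hlt, rfl⟩
      · rintro ⟨l, hl, rfl⟩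
        exact ⟨Finset.orderEmbOfFin_mem _ _ _, (OrderEmbedding.lt_iff_lt _).2 hl⟩
    rw [this, Finset.card_map, Fin.card_Iio]
  exact ⟨this ▸ k.2, by unfold increasingEnum; congr 1; exact Fin.ext this⟩

/-- The entries of the tuple increase in the lexicographic order of (level, index). -/
def IsInterleaved {n : ℕ} (s : Fin n → Finset ℕ) : Prop :=
  ∀ i j, ∀ v ∈ s i, ∀ w ∈ s j,
    (rankIn (s i) v < rankIn (s j) w ∨ rankIn (s i) v = rankIn (s j) w ∧ i < j) → v < w

theorem IsPlegma.isInterleaved {n : ℕ} {s : Fin n → Finset ℕ} (h : IsPlegma s) :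
    IsInterleaved s := by
  intro i j v hv w hw hlex
  obtain ⟨hi, hvi⟩ := exists_increasingEnum_eq hv
  obtain ⟨hj, hwj⟩ := exists_increasingEnum_eq hw
  rw [← hvi, ← hwj]
  rcases hlex with hlt | ⟨heq, hij⟩
  · refine (h.lt_next_level i j _ hi (lt_of_le_of_lt hlt hj)).trans_le ?_
    exact (s j).orderEmbOfFin rfl |>.monotone hlt
  · have := h.lt_same_level i j hij _ hi (heq ▸ hj)
    convert this using 3
    exact heq.symm

theorem IsInterleaved.castLE {n m : ℕ} {s : Fin m → Finset ℕ} (h : IsInterleaved s)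
    (hnm : n ≤ m) : IsInterleaved fun i : Fin n => s (Fin.castLE hnm i) :=
  fun _ _ v hv w hw hlex => h _ _ v hv w hw hlex

/-- Suppose `v` is a first difference, in `s i` but not in `t i`. By the antichain property `t i`
does not end before `v`, so it has some `w > v` at the level that `v` has in `s i`. As `v` lies in
`L` below `w`, it belongs to some `t j`, at a position before that of `w`. If `s j` reached `v` or
beyond, its entry at that position would have to precede `v`, which is absurd. So `s j` ends before
`v` and is properly contained in `t j`. -/
theorem mem_of_forall_lt_mem_iff {B : Set (Finset ℕ)} (hB : IsBarrier B) {n : ℕ}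
    {s t : Fin n → Finset ℕ} (hsB : ∀ i, s i ∈ B) (htB : ∀ i, t i ∈ B) (hs : IsInterleaved s)
    (ht : IsInterleaved t) {L : Set ℕ} (hsL : IsInitialSegmentOf (Finset.univ.biUnion s) L)
    (htL : IsInitialSegmentOf (Finset.univ.biUnion t) L) {v : ℕ}
    (ih : ∀ u < v, ∀ j, (u ∈ s j ↔ u ∈ t j)) {i : Fin n} (hv : v ∈ s i) : v ∈ t i := by
  have bounded : ∀ {a b : Finset ℕ}, a ∈ B → b ∈ B → v ∈ a → v ∉ b →
      (∀ u < v, (u ∈ a ↔ u ∈ b)) → ∃ w ∈ b, v ≤ w := by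
    intro a b ha hb hva hvb hab
    by_contra! hlt
    refine (hB.antichain b hb a ha ?_).1 fun u hu => (hab u (hlt u hu)).2 hu
    rintro rfl
    exact hvb hva
  by_contra hvt
  obtain ⟨w₀, hw₀, hvw₀⟩ := bounded (hsB i) (htB i) hv hvt fun u hu => ih u hu i
  obtain ⟨w, hw, hvw, hwr⟩ := exists_mem_rankIn_eq hw₀ hvw₀
  have hlt : v < w := lt_of_le_of_ne hvw fun h => hvt (h ▸ hw)
  have hvU : v ∈ Finset.univ.biUnion t := by
    refine htL.2 w (Finset.mem_biUnion.2 ⟨i, Finset.mem_univ _, hw⟩) v (hsL.1 ?_) hlt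
    exact Finset.mem_biUnion.2 ⟨i, Finset.mem_univ _, hv⟩
  obtain ⟨j, -, hvj⟩ := Finset.mem_biUnion.1 hvU
  have hri := rankIn_congr fun u hu => ih u hu i
  have hrj := rankIn_congr fun u hu => ih u hu j
  have hlex : rankIn (t j) v < rankIn (t i) w ∨ rankIn (t j) v = rankIn (t i) w ∧ j < i := by
    have hij : i ≠ j := by rintro rfl; exact hvt hvj
    by_contra hcon
    refine lt_asymm hlt (ht i j w hw v hvj ?_)
    rcases lt_trichotomy (rankIn (t j) v) (rankIn (t i) w) with h | h | h
    · exact absurd (Or.inl h) hcon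
    · refine Or.inr ⟨h.symm, lt_of_le_of_ne (not_lt.1 fun hji => hcon (Or.inr ⟨h, hji⟩)) hij⟩
    · exact Or.inl h
  have hself : ∀ w' ∈ s j, v ≤ w' → False := by
    intro w' hw' hvw'
    obtain ⟨u, hu, hvu, hur⟩ := exists_mem_rankIn_eq hw' hvw'
    refine absurd (hs j i u hu v hv ?_) (not_lt.2 hvu)
    rwa [hur, hri, hrj, ← hwr]
  obtain ⟨w', hw', hvw'⟩ := bounded (htB j) (hsB j) hvj (fun h => hself v h le_rfl)
    fun u hu => (ih u hu j).symm
  exact hself w' hw' hvw'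

/-- An interleaved tuple in a barrier is determined by its union. -/
theorem IsInterleaved.eq_of_isInitialSegmentOf {B : Set (Finset ℕ)} (hB : IsBarrier B) {n : ℕ}
    {s t : Fin n → Finset ℕ} (hsB : ∀ i, s i ∈ B) (htB : ∀ i, t i ∈ B) (hs : IsInterleaved s)
    (ht : IsInterleaved t) {L : Set ℕ} (hsL : IsInitialSegmentOf (Finset.univ.biUnion s) L)
    (htL : IsInitialSegmentOf (Finset.univ.biUnion t) L) : s = t := by
  have key : ∀ v i, (v ∈ s i ↔ v ∈ t i) := by
    intro v
    induction v using Nat.strong_induction_on with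
    | _ v ih =>
      exact fun i => ⟨mem_of_forall_lt_mem_iff hB hsB htB hs ht hsL htL ih,
        mem_of_forall_lt_mem_iff hB htB hsB ht hs htL hsL fun u hu j => (ih u hu j).symm⟩
  funext i
  ext v
  exact key v i

/-! ### Existence and Ramsey property of interleaved tuples. -/

/-- The members of the tuple `s` are interleaved and contained in `M`. -/
def IsInterleavedIn {B : Set (Finset ℕ)} {n : ℕ} (s : Fin n → B) (M : Set ℕ) : Prop :=
  IsInterleaved (fun i => (s i : Finset ℕ)) ∧ ∀ i, ((s i : Finset ℕ) : Set ℕ) ⊆ M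

theorem IsInterleavedIn.mono {B : Set (Finset ℕ)} {n : ℕ} {s : Fin n → B} {M M' : Set ℕ}
    (h : IsInterleavedIn s M) (hM : M ⊆ M') : IsInterleavedIn s M' :=
  ⟨h.1, fun i => (h.2 i).trans hM⟩

/-- Enumerate `M` and take an initial segment in `B` of each residue class of positions modulo `n`.
The sizes are not controlled, which interleaving permits and plegma would not. -/
theorem exists_isInterleavedIn {B : Set (Finset ℕ)} (hB : IsBarrier B) (n : ℕ) {M : Set ℕ}
    (hM : M.Infinite) : ∃ s : Fin n → B, IsInterleavedIn s M := by
  classical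
  have : Infinite M := hM.to_subtype
  let e := Nat.orderEmbeddingOfSet M
  have heM : ∀ k, e k ∈ M := fun k => by
    have : e k ∈ Set.range e := ⟨k, rfl⟩
    rwa [Nat.orderEmbeddingOfSet_range] at this
  have hmono : ∀ i : Fin n, StrictMono fun k => e (n * k + i) := fun i k l hkl =>
    e.strictMono (by have := Nat.mul_lt_mul_of_pos_left hkl i.pos; omega)
  have hex : ∀ i : Fin n, ∃ s : B,
      IsInitialSegmentOf (s : Finset ℕ) (Set.range fun k => e (n * k + i)) := fun i => by
    obtain ⟨s, hs, h⟩ := hB.exists_initial _ (Set.infinite_range_of_injective (hmono i).injective)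
    exact ⟨⟨s, hs⟩, h⟩
  choose s hs using hex
  have hrank : ∀ i, ∀ k, e (n * k + i) ∈ (s i : Finset ℕ) →
      rankIn (s i : Finset ℕ) (e (n * k + i)) = k := by
    intro i k hk
    have : (s i : Finset ℕ).filter (· < e (n * k + i)) =
        (Finset.range k).map ⟨_, (hmono i).injective⟩ := by
      ext u
      simp only [Finset.mem_filter, Finset.mem_map, Finset.mem_range,
        Function.Embedding.coeFn_mk]
      constructor
      · rintro ⟨hu, hlt⟩
        obtain ⟨l, rfl⟩ := (hs i).1 hu
        exact ⟨l, (hmono i).lt_iff_lt.1 hlt, rfl⟩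
      · rintro ⟨l, hl, rfl⟩
        exact ⟨(hs i).2 _ hk _ ⟨l, rfl⟩ (hmono i hl), hmono i hl⟩
    rw [rankIn, this, Finset.card_map, Finset.card_range]
  refine ⟨s, fun i j v hv w hw hlex => ?_, fun i v hv => ?_⟩
  · obtain ⟨k, rfl⟩ := (hs i).1 hv
    obtain ⟨l, rfl⟩ := (hs j).1 hw
    simp only at hv hw hlex ⊢
    rw [hrank i k hv, hrank j l hw] at hlex
    refine e.strictMono ?_
    rcases hlex with h | ⟨rfl, h⟩
    · have h1 : n * (k + 1) ≤ n * l := Nat.mul_le_mul_left n h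
      have := i.2
      rw [Nat.mul_succ] at h1
      omega
    · have : (i : ℕ) < j := h
      omega
  · obtain ⟨k, rfl⟩ := (hs i).1 hv
    exact heM _

theorem exists_forall_color_ne_or_forall_color_eq {B : Set (Finset ℕ)} (hB : IsBarrier B) {n : ℕ}
    {C : Type*} (c : (Fin n → B) → C) (κ : C) (N : Set ℕ) (hN : N.Infinite) :
    ∃ M ⊆ N, M.Infinite ∧ ((∀ s, IsInterleavedIn s M → c s ≠ κ) ∨
      ∀ s, IsInterleavedIn s M → c s = κ) := by
  obtain ⟨M, hMN, hM, h⟩ := exists_avoids_or_forall_exists_initial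
    {u | ∃ s : Fin n → B, IsInterleaved (fun i => (s i : Finset ℕ)) ∧ c s = κ ∧
      u = Finset.univ.biUnion fun i => (s i : Finset ℕ)} N hN
  refine ⟨M, hMN, hM, ?_⟩
  have hU : ∀ s : Fin n → B, IsInterleavedIn s M →
      ((Finset.univ.biUnion fun i => (s i : Finset ℕ) : Finset ℕ) : Set ℕ) ⊆ M :=
    fun s hs => by simpa using hs.2
  rcases h with h | h
  · exact Or.inl fun s hs hc => h _ ⟨s, hs.1, hc, rfl⟩ (hU s hs)
  · refine Or.inr fun s hs => ?_
    -- Continue the union of `s` to an infinite set inside `M`; the tuple `t` of colour `κ` found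
    -- there must be `s`.
    obtain ⟨_, ⟨t, ht, hc, rfl⟩, htL⟩ := h _ (Set.union_subset (hU s hs) (tailAbove_subset
      (Finset.univ.biUnion fun i => (s i : Finset ℕ)) M))
      ((infinite_tailAbove _ hM).mono Set.subset_union_right)
    have := hs.1.eq_of_isInitialSegmentOf hB (fun i => (s i).2) (fun i => (t i).2) ht
      (isInitialSegmentOf_union fun m hm => hm.2) htL
    rwa [show s = t from funext fun i => Subtype.ext (congrFun this i)]

/-- The Ramsey property of finite colourings of interleaved tuples in a barrier. -/
theorem exists_monochromatic {B : Set (Finset ℕ)} (hB : IsBarrier B) {n : ℕ}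
    {C : Type*} [Finite C] (c : (Fin n → B) → C) (N : Set ℕ) (hN : N.Infinite) :
    ∃ M ⊆ N, M.Infinite ∧ ∀ s t, IsInterleavedIn s M → IsInterleavedIn t M → c s = c t := by
  have := Fintype.ofFinite C
  obtain ⟨M, hMN, hM, h⟩ := exists_infinite_subset_forall_mem_finset
    (P := fun κ M => (∀ s, IsInterleavedIn s M → c s ≠ κ) ∨ ∀ s, IsInterleavedIn s M → c s = κ)
    (fun κ S T hTS => Or.imp (fun h s hs => h s (hs.mono hTS)) fun h s hs => h s (hs.mono hTS))
    (exists_forall_color_ne_or_forall_color_eq hB c) Finset.univ N hN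
  refine ⟨M, hMN, hM, fun s t hs ht => ?_⟩
  rcases h (c s) (Finset.mem_univ _) with h | h
  · exact absurd rfl (h s hs)
  · exact (h t ht).symm

/-! ### Total boundedness and completeness of the space of seminorms. -/

namespace NormalizedSeminorm

theorem abs_sub_le_sum {n : ℕ} (ρ : NormalizedSeminorm n) (a b : Fin n → ℝ) :
    |ρ a - ρ b| ≤ ∑ i, |a i - b i| :=
  (abs_sub_map_le_sub ρ.1 a b).trans (ρ.le_sum_abs (a - b))

theorem dist_le {n : ℕ} {ρ σ : NormalizedSeminorm n} {r : ℝ}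
    (h : ∀ a ∈ Set.Icc (-1 : Fin n → ℝ) 1, |ρ a - σ a| ≤ r) : dist ρ σ ≤ r :=
  ciSup_le fun a => h a a.2

theorem dist_le_natCast {n : ℕ} (ρ σ : NormalizedSeminorm n) : dist ρ σ ≤ n :=
  ciSup_le (abs_sub_le_of_mem ρ σ)

/-- The colour records the values on a finite net of the cube, rounded to multiples of `r / 4`.
Rounding and two passages to the net cost `r / 4` each. -/
theorem exists_finite_coloring (n : ℕ) {r : ℝ} (hr : 0 < r) :
    ∃ (C : Type) (_ : Finite C) (c : NormalizedSeminorm n → C),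
      ∀ ρ σ, c ρ = c σ → dist ρ σ < r := by
  -- The seminorms are 1-Lipschitz for the `ℓ¹` norm, so `n * δ ≤ r / 4` is needed; `n + 1` covers
  -- `n = 0`.
  set δ : ℝ := r / (4 * (n + 1)) with hδ
  have hδpos : 0 < δ := by positivity
  obtain ⟨A, -, hAfin, hA⟩ :=
    finite_cover_balls_of_compact (isCompact_Icc (a := (-1 : Fin n → ℝ)) (b := 1)) hδpos
  have := hAfin.to_subtype
  obtain ⟨K, hK⟩ : ∃ K : ℕ, ∀ a ∈ A, (∑ i, |a i|) / (r / 4) ≤ K := by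
    obtain ⟨b, hb⟩ := (hAfin.image fun a => (∑ i, |a i|) / (r / 4)).bddAbove
    obtain ⟨K, hK⟩ := exists_nat_ge b
    exact ⟨K, fun a ha => (hb ⟨a, ha, rfl⟩).trans hK⟩
  refine ⟨A → Fin (K + 1), inferInstance, fun ρ a => ⟨⌊ρ a / (r / 4)⌋₊, ?_⟩, ?_⟩
  · refine Nat.lt_succ_of_le (Nat.floor_le_of_le (le_trans ?_ (hK a a.2)))
    exact div_le_div_of_nonneg_right (ρ.le_sum_abs a) (by positivity)
  intro ρ σ hρσ
  have hclose : ∀ (τ : NormalizedSeminorm n) (a b : Fin n → ℝ), dist b a < δ →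
      |τ b - τ a| ≤ r / 4 := by
    intro τ a b hab
    refine (τ.abs_sub_le_sum b a).trans ?_
    have : ∑ i, |b i - a i| ≤ n * δ := by
      refine (Finset.sum_le_card_nsmul _ _ δ fun i _ => ?_).trans (by simp)
      exact (dist_le_pi_dist b a i).trans hab.le
    refine this.trans ?_
    rw [hδ, mul_div_assoc', div_le_div_iff₀ (by positivity) (by norm_num)]
    nlinarith
  refine lt_of_le_of_lt (dist_le (r := 3 * (r / 4)) fun b hb => ?_) (by linarith)
  obtain ⟨a, ha, hab⟩ := Set.mem_iUnion₂.1 (hA hb)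
  have hfloor : ⌊ρ a / (r / 4)⌋₊ = ⌊σ a / (r / 4)⌋₊ := congrArg Fin.val (congrFun hρσ ⟨a, ha⟩)
  have h4 : 0 < r / 4 := by positivity
  have hval : |ρ a - σ a| ≤ r / 4 := by
    have h1 := Nat.floor_le (div_nonneg (ρ.nonneg a) h4.le)
    have h2 := Nat.floor_le (div_nonneg (σ.nonneg a) h4.le)
    have h3 := Nat.lt_floor_add_one (ρ a / (r / 4))
    have h5 := Nat.lt_floor_add_one (σ a / (r / 4))
    rw [hfloor] at h1 h3
    rw [le_div_iff₀ h4] at h1 h2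
    rw [div_lt_iff₀ h4] at h3 h5
    exact abs_le.2 ⟨by linarith, by linarith⟩
  have h1 := abs_le.1 (hclose ρ a b hab)
  have h2 := abs_le.1 (hclose σ a b hab)
  have h3 := abs_le.1 hval
  exact abs_le.2 ⟨by linarith, by linarith⟩

theorem abs_sub_le_mul_dist {n : ℕ} (ρ σ : NormalizedSeminorm n) (a : Fin n → ℝ) :
    |ρ a - σ a| ≤ (‖a‖ + 1) * dist ρ σ := by
  have hpos : 0 < ‖a‖ + 1 := by positivity
  have hmem : (‖a‖ + 1)⁻¹ • a ∈ Set.Icc (-1 : Fin n → ℝ) 1 := by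
    have key : ∀ i, |((‖a‖ + 1)⁻¹ • a) i| ≤ 1 := fun i => by
      rw [Pi.smul_apply, smul_eq_mul, abs_mul, abs_of_pos (inv_pos.2 hpos), inv_mul_le_iff₀ hpos]
      have := norm_le_pi_norm a i
      rw [Real.norm_eq_abs] at this
      linarith
    exact ⟨fun i => (abs_le.1 (key i)).1, fun i => (abs_le.1 (key i)).2⟩
  have h : |ρ.1 ((‖a‖ + 1)⁻¹ • a) - σ.1 ((‖a‖ + 1)⁻¹ • a)| ≤ dist ρ σ :=
    abs_sub_le_dist ρ σ ⟨_, hmem⟩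
  rwa [map_smul_eq_mul, map_smul_eq_mul, ← mul_sub, abs_mul, abs_norm,
    Real.norm_of_nonneg (inv_pos.2 hpos).le, inv_mul_le_iff₀ hpos] at h

theorem tendsto_apply {n : ℕ} {u : ℕ → NormalizedSeminorm n} {ρ : NormalizedSeminorm n}
    (h : Filter.Tendsto u Filter.atTop (nhds ρ)) (a : Fin n → ℝ) :
    Filter.Tendsto (fun k => u k a) Filter.atTop (nhds (ρ a)) := by
  rw [tendsto_iff_dist_tendsto_zero] at h ⊢
  refine squeeze_zero (fun _ => dist_nonneg) (fun k => abs_sub_le_mul_dist (u k) ρ a) ?_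
  simpa using h.const_mul (‖a‖ + 1)

instance {n : ℕ} : CompleteSpace (NormalizedSeminorm n) := by
  refine Metric.complete_of_cauchySeq_tendsto fun u hu => ?_
  have hptwise : ∀ a : Fin n → ℝ, CauchySeq fun k => u k a := fun a => by
    rw [Metric.cauchySeq_iff] at hu ⊢
    intro ε hε
    have hpos : 0 < ‖a‖ + 1 := by positivity
    obtain ⟨K, hK⟩ := hu (ε / (‖a‖ + 1)) (div_pos hε hpos)
    refine ⟨K, fun k hk l hl => (abs_sub_le_mul_dist (u k) (u l) a).trans_lt ?_⟩
    rw [mul_comm]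
    exact (lt_div_iff₀ hpos).1 (hK k hk l hl)
  choose f hf using fun a => cauchySeq_tendsto_of_complete (hptwise a)
  let ρ : NormalizedSeminorm n :=
    ⟨Seminorm.of f
      (fun a b => le_of_tendsto_of_tendsto' (hf _) ((hf a).add (hf b))
        fun k => map_add_le_add (u k).1 a b)
      (fun c a => tendsto_nhds_unique (hf _) (by
        simpa only [map_smul_eq_mul] using (hf a).const_mul ‖c‖)),
      fun i => tendsto_nhds_unique (hf _) (by
        simp only [(u _).2 i]
        exact tendsto_const_nhds)⟩
  refine ⟨ρ, Metric.tendsto_atTop.2 fun ε hε => ?_⟩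
  obtain ⟨K, hK⟩ := Metric.cauchySeq_iff.1 hu (ε / 2) (half_pos hε)
  refine ⟨K, fun k hk => lt_of_le_of_lt (dist_le fun a ha => ?_) (half_lt_self hε)⟩
  refine le_of_tendsto ((tendsto_const_nhds.sub (hf a)).abs) ?_
  filter_upwards [Filter.eventually_ge_atTop K] with l hl
  exact (abs_sub_le_dist (u k) (u l) ⟨a, ha⟩).trans (hK k hk l hl).le

end NormalizedSeminorm

/-! ### Limits along tuples moving to infinity. -/

/-- The seminorm `a ↦ ‖∑ i, a i • v i‖` given by unit vectors `v i`. -/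
noncomputable def seminormOfUnitVectors {X : Type*} [NormedAddCommGroup X] [NormedSpace ℝ X]
    {n : ℕ} (v : Fin n → Metric.sphere (0 : X) 1) : NormalizedSeminorm n :=
  ⟨Seminorm.of (fun a => ‖∑ i : Fin n, a i • (v i : X)‖)
    (fun a b => by
      simp only [Pi.add_apply, add_smul, Finset.sum_add_distrib]
      exact norm_add_le _ _)
    (fun c a => by
      simp only [Pi.smul_apply, smul_eq_mul, mul_smul, ← Finset.smul_sum]
      exact norm_smul _ _),
    fun i => by
      change ‖∑ j : Fin n, (Pi.single i (1 : ℝ) : Fin n → ℝ) j • (v j : X)‖ = 1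
      rw [Finset.sum_eq_single i (fun j _ hj => by simp [Pi.single_eq_of_ne hj])
        (fun h => absurd (Finset.mem_univ i) h)]
      simp⟩

theorem sum_extendByZero_smul {X : Type*} [AddCommGroup X] [Module ℝ X] {n m : ℕ} (h : n ≤ m)
    (a : Fin n → ℝ) (v : Fin m → X) :
    ∑ i, extendByZero m a i • v i = ∑ i, a i • v (Fin.castLE h i) := by
  have hinj : Function.Injective (Fin.castLE h) := Fin.castLE_injective h
  refine (Finset.sum_of_injOn (Fin.castLE h) hinj.injOn (by simp) (fun i _ hi => ?_)
    fun i _ => ?_).symm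
  · have : ¬ (i : ℕ) < n := fun hlt => hi ⟨⟨i, hlt⟩, by simp, rfl⟩
    simp [extendByZero, this]
  · simp [extendByZero]

theorem seminormOfUnitVectors_extendByZero {X : Type*} [NormedAddCommGroup X] [NormedSpace ℝ X]
    {n m : ℕ} (h : n ≤ m) (v : Fin m → Metric.sphere (0 : X) 1) (a : Fin n → ℝ) :
    seminormOfUnitVectors v (extendByZero m a) =
      seminormOfUnitVectors (fun i => v (Fin.castLE h i)) a :=
  congrArg norm (sum_extendByZero_smul h a fun i => (v i : X))

/-- The values of `Φ` at interleaved tuples in `M` tend to `y` as the tuples move to infinity. -/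
def InterleavedTendsto {B : Set (Finset ℕ)} {n : ℕ} {Y : Type*} [MetricSpace Y]
    (Φ : (Fin n → B) → Y) (M : Set ℕ) (y : Y) : Prop :=
  ∀ r > 0, ∃ a, ∀ s, IsInterleavedIn s (M ∩ Set.Ici a) → dist (Φ s) y ≤ r

theorem infinite_inter_Ici {M : Set ℕ} (hM : M.Infinite) (a : ℕ) : (M ∩ Set.Ici a).Infinite :=
  (hM.sdiff (Set.finite_Iio a)).mono fun _ hm => ⟨hm.1, not_lt.1 fun h => hm.2 (Set.mem_Iio.2 h)⟩

theorem inter_Ici_subset (M : Set ℕ) {a b : ℕ} (h : a ≤ b) : M ∩ Set.Ici b ⊆ M ∩ Set.Ici a :=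
  Set.inter_subset_inter_right M (Set.Ici_subset_Ici.2 h)

theorem InterleavedTendsto.tendsto {B : Set (Finset ℕ)} {n : ℕ} {Y : Type*} [MetricSpace Y]
    {Φ : (Fin n → B) → Y} {M : Set ℕ} {y : Y} (h : InterleavedTendsto Φ M y)
    {u : ℕ → Fin n → B} (hu : ∀ q, IsInterleavedIn (u q) (M ∩ Set.Ici q)) :
    Filter.Tendsto (fun q => Φ (u q)) Filter.atTop (nhds y) := by
  refine Metric.tendsto_atTop.2 fun r hr => ?_
  obtain ⟨a, ha⟩ := h (r / 2) (half_pos hr)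
  exact ⟨a, fun q hq => (ha _ ((hu q).mono (inter_Ici_subset M hq))).trans_lt (half_lt_self hr)⟩

/-- One sequence of tuples moving to infinity has Cauchy values; small oscillation makes its limit
valid for all tuples. -/
theorem exists_interleavedTendsto_of_small_oscillation {B : Set (Finset ℕ)} (hB : IsBarrier B)
    {n : ℕ} {Y : Type*} [MetricSpace Y] [CompleteSpace Y] {Φ : (Fin n → B) → Y} {M : Set ℕ}
    (hM : M.Infinite)
    (h : ∀ r > 0, ∃ a, ∀ s t, IsInterleavedIn s (M ∩ Set.Ici a) →
      IsInterleavedIn t (M ∩ Set.Ici a) → dist (Φ s) (Φ t) < r) :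
    ∃ y, InterleavedTendsto Φ M y := by
  choose u hu using fun q => exists_isInterleavedIn hB n (infinite_inter_Ici hM q)
  have hcauchy : CauchySeq fun q => Φ (u q) := by
    refine Metric.cauchySeq_iff.2 fun r hr => ?_
    obtain ⟨a, ha⟩ := h r hr
    exact ⟨a, fun p hp q hq => ha _ _ ((hu p).mono (inter_Ici_subset M hp))
      ((hu q).mono (inter_Ici_subset M hq))⟩
  obtain ⟨y, hy⟩ := cauchySeq_tendsto_of_complete hcauchy
  refine ⟨y, fun r hr => ?_⟩
  obtain ⟨a, ha⟩ := h r hr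
  refine ⟨a, fun s hs => le_of_tendsto (tendsto_const_nhds.dist hy) ?_⟩
  filter_upwards [Filter.eventually_ge_atTop a] with q hq
  exact (ha _ _ hs ((hu q).mono (inter_Ici_subset M hq))).le

theorem InterleavedTendsto.plegmaConvergesOn {B : Set (Finset ℕ)} {n : ℕ} {Y : Type*}
    [MetricSpace Y] {Φ : (Fin n → B) → Y} {M : Set ℕ} {y : Y} (h : InterleavedTendsto Φ M y)
    {b : ℝ} (hb : ∀ s, dist (Φ s) y ≤ b) :
    PlegmaConvergesOn (fun s : plegmaFamily B n => Φ fun i => ⟨s.1 i, s.2.1 i⟩) M y := by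
  let D : ℕ → Set ℝ := fun m => {d | ∃ s, IsInterleavedIn s (M ∩ Set.Ici m) ∧ dist (Φ s) y = d}
  have hbdd : ∀ m, BddAbove (D m) := fun m => ⟨b, by rintro _ ⟨s, -, rfl⟩; exact hb s⟩
  have hnonneg : ∀ m, 0 ≤ sSup (D m) := fun m =>
    Real.sSup_nonneg (by rintro _ ⟨s, -, rfl⟩; exact dist_nonneg)
  have hanti : Antitone fun m => sSup (D m) := by
    intro m k hmk
    refine Real.sSup_le ?_ (hnonneg m)
    rintro _ ⟨s, hs, rfl⟩
    exact le_csSup (hbdd m) ⟨s, hs.mono (inter_Ici_subset M hmk), rfl⟩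
  have hlim : Filter.Tendsto (fun m => sSup (D m)) Filter.atTop (nhds 0) := by
    refine Metric.tendsto_atTop.2 fun r hr => ?_
    obtain ⟨a, ha⟩ := h (r / 2) (half_pos hr)
    refine ⟨a, fun m hm => ?_⟩
    rw [Real.dist_0_eq_abs, abs_of_nonneg (hnonneg m)]
    refine lt_of_le_of_lt (Real.sSup_le ?_ (half_pos hr).le) (half_lt_self hr)
    rintro _ ⟨s, hs, rfl⟩
    exact ha s (hs.mono (inter_Ici_subset M hm))
  -- The supremum bounds the distance only weakly and may vanish; the added term makes it strict and
  -- positive.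
  refine ⟨fun m => sSup (D m) + 1 / ((m : ℝ) + 1), fun m => ?_, fun m k hmk => ?_, ?_, ?_⟩
  · exact add_pos_of_nonneg_of_pos (hnonneg m) Nat.one_div_pos_of_nat
  · exact add_le_add (hanti hmk) (Nat.one_div_le_one_div hmk)
  · simpa using hlim.add tendsto_one_div_add_atTop_nhds_zero_nat
  · intro s hs m hm
    refine lt_of_le_of_lt (le_csSup (hbdd m) ⟨_, ⟨s.2.2.isInterleaved, fun i k hk => ?_⟩, rfl⟩)
      (lt_add_of_pos_right _ Nat.one_div_pos_of_nat)
    exact ⟨(hs.1 i).2 hk, hm i k hk⟩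

theorem mainTheorem5 {X : Type*} [NormedAddCommGroup X] [NormedSpace ℝ X] [CompleteSpace X]
    (B : Set (Finset ℕ)) (hB : IsBarrier B) (x : FamilyMatrix B X)
    (N : Set ℕ) (hN : N.Infinite) :
    ∃ M : Set ℕ, M ⊆ N ∧ M.Infinite ∧
      ∃ ρ : (n : ℕ) → NormalizedSeminorm n,
        (∀ n m : ℕ, n < m → Compatible (ρ n) (ρ m)) ∧
        ∀ n : ℕ, PlegmaConvergesOn (inducedSeminorm x n) M (ρ n) := by
  -- Defined on all tuples in `B`, since the limits are tested on interleaved tuples that need not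
  -- be plegma.
  let Φ : (n : ℕ) → (Fin n → B) → NormalizedSeminorm n :=
    fun n s => seminormOfUnitVectors fun i => x i (s i)
  obtain ⟨M, hMN, hM, hosc⟩ := exists_infinite_subset_forall_exists_tail
    (P := fun (p : ℕ × ℕ) S => ∀ s t, IsInterleavedIn s S → IsInterleavedIn t S →
      dist (Φ p.1 s) (Φ p.1 t) < 1 / ((p.2 : ℝ) + 1))
    (fun p S T hTS h s t hs ht => h s t (hs.mono hTS) (ht.mono hTS))
    (fun p S hS => by
      obtain ⟨C, _, c, hc⟩ := NormalizedSeminorm.exists_finite_coloring p.1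
        (Nat.one_div_pos_of_nat (α := ℝ) (n := p.2))
      obtain ⟨M, hMS, hM, h⟩ := exists_monochromatic hB (fun s => c (Φ p.1 s)) S hS
      exact ⟨M, hMS, hM, fun s t hs ht => hc _ _ (h s t hs ht)⟩) N hN
  have hlim : ∀ n, ∃ ρ, InterleavedTendsto (Φ n) M ρ := fun n =>
    exists_interleavedTendsto_of_small_oscillation hB hM fun r hr => by
      obtain ⟨j, hj⟩ := exists_nat_one_div_lt hr
      obtain ⟨a, ha⟩ := hosc (n, j)
      exact ⟨a, fun s t hs ht => (ha s t hs ht).trans hj⟩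
  choose ρ hρ using hlim
  refine ⟨M, hMN, hM, ρ, fun n m hnm a => ?_, fun n =>
    (hρ n).plegmaConvergesOn fun s => NormalizedSeminorm.dist_le_natCast _ _⟩
  -- The same `m`-tuples serve both limits, through their first `n` entries for `ρ n`.
  choose u hu using fun q => exists_isInterleavedIn hB m (infinite_inter_Ici hM q)
  have hm := NormalizedSeminorm.tendsto_apply ((hρ m).tendsto hu) (extendByZero m a)
  have hn := NormalizedSeminorm.tendsto_apply ((hρ n).tendsto
    (u := fun q i => u q (Fin.castLE hnm.le i))
    fun q => ⟨(hu q).1.castLE hnm.le, fun i => (hu q).2 _⟩) a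
  refine tendsto_nhds_unique hm (hn.congr fun q => ?_)
  exact (seminormOfUnitVectors_extendByZero hnm.le (fun i => x i (u q i)) a).symm
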